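/- For an integer $d\ge 2$ let $f_{c,d}(x)=x^d+c$, where $c$ is an indeterminate, and let $f_{c,d}^k(0)\in\mathbb{Z}[c]$ denote the value at $0$ of its $k$-th iterate. For $n\ge 1$ put $G_{d,0,n}(c)=\prod_{k\mid n}\bigl(f_{c,d}^k(0)\bigr)^{\mu(n/k)}$, where $\mu$ is the Möbius function. For $m\ge 1$ put $$F_{d,m,n}(c)=\prod_{k\mid n}\left(\frac{f_{c,d}^{m+k}(0)-f_{c,d}^{m}(0)}{f_{c,d}^{m-1+k}(0)-f_{c,d}^{m-1}(0)}\right)^{\mu(n/k)},$$ and for $m\ge 2$ let the Misiurewicz polynomial be $G_{d,m,n}=F_{d,m,n}$ if $n\nmid m-1$ and $G_{d,m,n}=F_{d,m,n}/F_{d,1,n}$ if $n\mid m-1$. Put $M_{m,n}=d^{m-1}(d-1)$ if $n\nmid m-1$ and $M_{m,n}=(d^{m-1}-1)(d-1)$ if $n\mid m-1$. **Theorem 1.4.** Let $d$ be a prime, $m\ge 2$ and $n\ge 1$. Then $G_{d,0,n}$ and $G_{d,m,n}$ are polynomials in $c$ with integer coefficients, and the following hold. 1. The number of irreducible factors of $G_{d,m,n}(c)$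 over $\mathbb{Q}$, counted with multiplicity, is at most the number of distinct monic irreducible factors of the reduction $\overline{G_{d,0,n}}(c)\in\mathbb{F}_d[c]$ of $G_{d,0,n}$ modulo $d$. 2. In particular, if $\overline{G_{d,0,n}}(c)$ is irreducible over $\mathbb{F}_d$, then $G_{d,m,n}(c)$ is irreducible over $\mathbb{Q}$. 3. If $H(c)\in\mathbb{Z}[c]$ is a monic factor of $G_{d,m,n}(c)$ that is irreducible over $\mathbb{Q}$, then its reduction modulo $d$ is $\overline{H}(c)=A(c)^{M_{m,n}}$ for some $A(c)\in\mathbb{F}_d[c]$. -/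

import Mathlib

open Polynomial

namespace Misiurewicz

/-- The polynomial map `f_{c,d}(x) = x ^ d + c`, with the parameter `c` an indeterminate
(the variable `X` of `ℤ[X]`), acting on `x ∈ ℤ[c]`. -/
noncomputable def f (d : ℕ) (x : ℤ[X]) : ℤ[X] := x ^ d + X

/-- The critical orbit `f_{c,d}^k(0) ∈ ℤ[c]`. -/
noncomputable def orbit (d k : ℕ) : ℤ[X] := (f d)^[k] 0

/-- `f_{c,d}^k(0)`, seen in the field of rational functions `ℚ(c) = Frac ℤ[c]`. -/
noncomputable def a (d k : ℕ) : FractionRing ℤ[X] :=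
  algebraMap ℤ[X] (FractionRing ℤ[X]) (orbit d k)

/-- The rational function
`F_{d,m,n} = ∏_{k ∣ n} ((f^{m+k}(0) - f^m(0)) / (f^{m-1+k}(0) - f^{m-1}(0))) ^ μ(n/k)`,
for `m ≥ 1`. -/
noncomputable def F (d m n : ℕ) : FractionRing ℤ[X] :=
  ∏ k ∈ n.divisors,
    ((a d (m + k) - a d m) / (a d (m - 1 + k) - a d (m - 1))) ^ ArithmeticFunction.moebius (n / k)

/-- `G_{d,m,n}` as a rational function of `c`, for `m = 0` and for `m ≥ 2`
(the value at `m = 1` plays no role). -/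
noncomputable def G (d m n : ℕ) : FractionRing ℤ[X] :=
  if m = 0 then ∏ k ∈ n.divisors, a d k ^ ArithmeticFunction.moebius (n / k)
  else if n ∣ m - 1 then F d m n / F d 1 n
  else F d m n

/-- The exponent `M_{m,n}` (for a given `d`). -/
def M (d m n : ℕ) : ℕ :=
  if n ∣ m - 1 then (d ^ (m - 1) - 1) * (d - 1) else d ^ (m - 1) * (d - 1)

end Misiurewicz

/-!
The polynomial `G_{d,m,n}` is congruent modulo `d` to the `M`-th power of `G_{d,0,n}`, and the
reduction of `G_{d,0,n}` is squarefree. It therefore suffices to show that, for an integral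
irreducible factor `H` of `G_{d,m,n}`, every irreducible factor of the reduction of `H` occurs in it
at least `M` times; the bound on the number of factors follows by counting.

*Integrality.* Write `a_k = f^k(0)` and let `Phi d j k` be the quotient of `a_{j+1+k} - a_{j+1}` by
`a_{j+k} - a_j`, a monic polynomial. At each prime `q` of `ℤ[c]` the valuation of `a_k`, and that of
`Phi d j k`, is constant on the multiples `k` of some period and zero elsewhere
(`multiplicity_orbit`, `exists_multiplicity_Phi`). For `a_k` this holds because `0` is critical, for
`Phi d j k` because multipliers of cycles are divisible by `d` and hence never roots of unity modulo
`q`. Möbius products of such sequences are integral (`exists_moebius_prod`). Modulo `d` the map `f`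
is additive up to translation, so that `a_{j+k} - a_j ≡ a_k ^ (d ^ j)`, which gives the congruence
between `G_{d,m,n}` and `G_{d,0,n}`; all this is collected in `exists_polynomials`.

*The multiplicity.* Put `j = m - 1`. In the domain `ℤ[c] / (H)` the element `Phi d j n` vanishes,
that is, `a_{j+n}` is a primitive `d`-th root of unity times `a_j`. For a valuation of this domain
centred at a prime `(d, π)`, comparing the differences `a_{i+n} - a_i` for `i ≤ j` shows that `d` is
divisible by `a_n ^ M` (`valuation_natCast_le`). If `H ≡ π ^ e * h` modulo `d`, with `π` not dividing
`h`, then `π` divides the reduction of `a_n`, so `a_n ^ e * h` is a multiple of `d` modulo `H`; as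
`h` is a unit for the valuation, `M ≤ e` (`le_multiplicity_map`).
-/

namespace Misiurewicz

/-! ### The critical orbit -/

section CriticalOrbit

variable (d : ℕ)

lemma orbit_zero : orbit d 0 = 0 := rfl

lemma orbit_add (j k : ℕ) : orbit d (j + k) = (f d)^[k] (orbit d j) := by
  rw [orbit, orbit, add_comm, Function.iterate_add_apply]

lemma orbit_succ (k : ℕ) : orbit d (k + 1) = orbit d k ^ d + X := by
  rw [orbit_add]; rfl

lemma sub_dvd_iterate_sub (k : ℕ) (x y : ℤ[X]) : x - y ∣ (f d)^[k] x - (f d)^[k] y := by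
  induction k generalizing x y with
  | zero => simp
  | succ k ih =>
    rw [Function.iterate_succ_apply, Function.iterate_succ_apply]
    refine dvd_trans ?_ (ih _ _)
    simpa [f] using sub_dvd_pow_sub_pow x y d

lemma orbit_succ_monic_natDegree {d : ℕ} (hd : 2 ≤ d) (k : ℕ) :
    (orbit d (k + 1)).Monic ∧ (orbit d (k + 1)).natDegree = d ^ k := by
  induction k with
  | zero => simp [orbit_succ, orbit_zero, show d ≠ 0 by omega, monic_X]
  | succ k ih =>
    obtain ⟨h1, h2⟩ := ih
    have h3 : (orbit d (k + 1) ^ d).natDegree = d ^ (k + 1) := by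
      rw [h1.natDegree_pow, h2, pow_succ']
    have h4 : (X : ℤ[X]).degree < (orbit d (k + 1) ^ d).degree := by
      apply degree_lt_degree
      rw [h3, natDegree_X]
      exact Nat.one_lt_pow (by omega) (by omega)
    rw [orbit_succ]
    exact ⟨(h1.pow d).add_of_left h4, by rw [natDegree_add_eq_left_of_degree_lt h4, h3]⟩

lemma orbit_monic {d : ℕ} (hd : 2 ≤ d) {k : ℕ} (hk : 1 ≤ k) : (orbit d k).Monic := by
  obtain ⟨k, rfl⟩ := Nat.exists_eq_add_of_le' hk
  exact (orbit_succ_monic_natDegree hd k).1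

lemma orbit_sub_monic {d : ℕ} (hd : 2 ≤ d) (j : ℕ) {k : ℕ} (hk : 1 ≤ k) :
    (orbit d (j + k) - orbit d j).Monic := by
  have h := orbit_monic hd (show 1 ≤ j + k by omega)
  refine h.sub_of_left ?_
  rcases j with _ | j
  · rw [orbit_zero, degree_zero, bot_lt_iff_ne_bot, Ne, degree_eq_bot]
    exact h.ne_zero
  · apply degree_lt_degree
    rw [show j + 1 + k = (j + k) + 1 by ring, (orbit_succ_monic_natDegree hd j).2,
      (orbit_succ_monic_natDegree hd (j + k)).2]
    exact Nat.pow_lt_pow_right (by omega) (by omega)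

/-- The polynomial `∑ i < d, x ^ i * y ^ (d - 1 - i)` with `x = f^{j+k}(0)` and `y = f^j(0)`, that
is, the quotient of `f^{j+1+k}(0) - f^{j+1}(0)` by `f^{j+k}(0) - f^j(0)`. -/
noncomputable def Phi (j k : ℕ) : ℤ[X] :=
  ∑ i ∈ Finset.range d, orbit d (j + k) ^ i * orbit d j ^ (d - 1 - i)

lemma Phi_mul (j k : ℕ) :
    Phi d j k * (orbit d (j + k) - orbit d j) = orbit d (j + 1 + k) - orbit d (j + 1) := by
  rw [Phi, Commute.geom_sum₂_mul (Commute.all _ _), show j + 1 + k = j + k + 1 by ring, orbit_succ,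
    orbit_succ]
  ring

lemma Phi_monic {d : ℕ} (hd : 2 ≤ d) (j : ℕ) {k : ℕ} (hk : 1 ≤ k) : (Phi d j k).Monic := by
  refine (orbit_sub_monic hd j hk).of_mul_monic_right ?_
  rw [Phi_mul]
  exact orbit_sub_monic hd _ hk

lemma Phi_zero {d : ℕ} (hd : 2 ≤ d) (k : ℕ) : Phi d 0 k = orbit d k ^ (d - 1) := by
  obtain ⟨e, rfl⟩ := Nat.exists_eq_add_of_le' (show 1 ≤ d by omega)
  rw [Phi, Finset.sum_range_succ, Finset.sum_eq_zero]
  · simp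
  · intro i hi
    have := Finset.mem_range.1 hi
    rw [orbit_zero, zero_pow (by omega), mul_zero]

lemma sub_dvd_Phi_sub (j k : ℕ) :
    orbit d (j + k) - orbit d j ∣ Phi d j k - d * orbit d j ^ (d - 1) := by
  have h : (d : ℤ[X]) * orbit d j ^ (d - 1)
      = ∑ i ∈ Finset.range d, orbit d j ^ i * orbit d j ^ (d - 1 - i) := by
    rw [Finset.sum_congr rfl (g := fun _ => orbit d j ^ (d - 1)), Finset.sum_const,
      Finset.card_range, nsmul_eq_mul]
    intro i hi
    have := Finset.mem_range.1 hi
    rw [← pow_add]; congr 1; omega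
  rw [Phi, h, ← Finset.sum_sub_distrib]
  refine Finset.dvd_sum fun i _ => ?_
  rw [← sub_mul]
  exact (sub_dvd_pow_sub_pow _ _ _).mul_right _

/-- Over `ℤ[c]` the difference quotient of an iterate of `f` is, up to multiples of `d`, divisible
by the difference itself: the derivative of `f` is divisible by `d`. -/
lemma iterate_sub_iterate {p : ℕ} (hp : 1 ≤ p) (x y : ℤ[X]) :
    ∃ s t : ℤ[X], (f d)^[p] x - (f d)^[p] y = (x - y) * (d * s + (x - y) * t) := by
  obtain ⟨p, rfl⟩ := Nat.exists_eq_add_of_le' hp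
  obtain ⟨w, hw⟩ := sub_dvd_iterate_sub d p (f d x) (f d y)
  obtain ⟨k, hk⟩ := Polynomial.binomExpansion (X ^ d : ℤ[X][X]) y (x - y)
  simp only [eval_pow, eval_X, derivative_X_pow, eval_mul, add_sub_cancel] at hk
  refine ⟨y ^ (d - 1) * w, k * w, ?_⟩
  rw [Function.iterate_succ_apply, Function.iterate_succ_apply, hw, f, f]
  simp only [map_natCast, eval_natCast] at hk
  linear_combination w * hk

end CriticalOrbit

/-! ### Möbius products in a unique factorization domain -/

section MoebiusProduct

open ArithmeticFunction

lemma sum_divisors_moebius_mul (p e : ℕ) {n : ℕ} (hn : 1 ≤ n) :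
    ∑ k ∈ n.divisors, moebius (n / k) * ((if p ∣ k then e else 0 : ℕ) : ℤ) =
      ((if n = p then e else 0 : ℕ) : ℤ) := by
  have key := (sum_eq_iff_sum_smul_moebius_eq (R := ℤ)
    (f := fun n => ((if n = p then e else 0 : ℕ) : ℤ))
    (g := fun n => ((if p ∣ n then e else 0 : ℕ) : ℤ))).1 ?_ n hn
  · rw [← key, Nat.sum_divisorsAntidiagonal' (f := fun i j =>
      moebius i • ((if p ∣ j then e else 0 : ℕ) : ℤ))]
    simp only [smul_eq_mul]
  · intro m hm
    rw [← Nat.cast_sum, Finset.sum_ite_eq']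
    simp [hm.ne']

variable {R : Type*} [CommRing R] [IsDomain R] [UniqueFactorizationMonoid R]

lemma multiplicity_prod_pow {q : R} (hq : Prime q) (s : Finset ℕ) (b : ℕ → R) (e : ℕ → ℕ)
    (hb : ∀ k ∈ s, b k ≠ 0) :
    multiplicity q (∏ k ∈ s, b k ^ e k) = ∑ k ∈ s, e k * multiplicity q (b k) := by
  induction s using Finset.cons_induction with
  | empty => simpa using multiplicity_of_one_right hq.not_isUnit
  | cons k s hk ih =>
    have h1 : b k ≠ 0 := hb k (Finset.mem_cons_self _ _)
    have h2 : ∀ i ∈ s, b i ≠ 0 := fun i hi => hb i (Finset.mem_cons_of_mem hi)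
    rw [Finset.prod_cons, Finset.sum_cons, multiplicity_mul hq, ih h2,
      (FiniteMultiplicity.of_prime_left hq h1).multiplicity_pow hq]
    exact .of_prime_left hq (mul_ne_zero (pow_ne_zero _ h1)
      (Finset.prod_ne_zero_iff.2 fun i hi => pow_ne_zero _ (h2 i hi)))

lemma dvd_of_multiplicity_le {a b : R} (ha : a ≠ 0) (hb : b ≠ 0)
    (h : ∀ q : R, Prime q → multiplicity q a ≤ multiplicity q b) : a ∣ b := by
  rw [UniqueFactorizationMonoid.dvd_iff_emultiplicity_le ha]
  intro q hq
  rw [(FiniteMultiplicity.of_prime_left hq ha).emultiplicity_eq_multiplicity,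
    (FiniteMultiplicity.of_prime_left hq hb).emultiplicity_eq_multiplicity]
  exact_mod_cast h q hq

/-- Let `b` be a sequence in a UFD such that for each prime `q` the valuation of `b k` at `q` is
constant on the multiples of some `p` and vanishes elsewhere (a rigid divisibility sequence). Then
the Möbius products `∏_{k ∣ n} b k ^ μ(n/k)` lie in the ring: by Möbius inversion the valuation at
`q` of the `n`-th one is the constant if `n = p`, and zero otherwise. -/
lemma exists_moebius_prod (K : Type*) [Field K] [Algebra R K] [IsFractionRing R K] (b : ℕ → R)
    (hb : ∀ k, 1 ≤ k → b k ≠ 0)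
    (hv : ∀ q : R, Prime q → ∃ p e : ℕ, ∀ k, 1 ≤ k → multiplicity q (b k) =
      if p ∣ k then e else 0) :
    ∃ g : ℕ → R, ∀ n, 1 ≤ n → g n ≠ 0 ∧
      algebraMap R K (g n) = ∏ k ∈ n.divisors, algebraMap R K (b k) ^ moebius (n / k) ∧
      ∏ k ∈ n.divisors, g k = b n ∧
      ∀ q : R, Prime q → (multiplicity q (g n) : ℤ) =
        ∑ k ∈ n.divisors, moebius (n / k) * multiplicity q (b k) := by
  have hinj := FaithfulSMul.algebraMap_injective R K
  have main : ∀ n, 1 ≤ n → ∃ g : R, g ≠ 0 ∧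
      algebraMap R K g = ∏ k ∈ n.divisors, algebraMap R K (b k) ^ moebius (n / k) ∧
      ∀ q : R, Prime q → (multiplicity q g : ℤ) =
        ∑ k ∈ n.divisors, moebius (n / k) * multiplicity q (b k) := by
    intro n hn
    have hbk : ∀ k ∈ n.divisors, b k ≠ 0 := fun k hk => hb k (Nat.pos_of_mem_divisors hk)
    set num := ∏ k ∈ n.divisors, b k ^ (moebius (n / k)).toNat with hnum
    set den := ∏ k ∈ n.divisors, b k ^ (-moebius (n / k)).toNat with hden
    have num0 : num ≠ 0 := Finset.prod_ne_zero_iff.2 fun k hk => pow_ne_zero _ (hbk k hk)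
    have den0 : den ≠ 0 := Finset.prod_ne_zero_iff.2 fun k hk => pow_ne_zero _ (hbk k hk)
    have hsum : ∀ q : R, Prime q → (multiplicity q num : ℤ) = multiplicity q den +
        ∑ k ∈ n.divisors, moebius (n / k) * multiplicity q (b k) := by
      intro q hq
      rw [hnum, hden, multiplicity_prod_pow hq _ _ _ hbk, multiplicity_prod_pow hq _ _ _ hbk]
      push_cast
      rw [← Finset.sum_add_distrib]
      refine Finset.sum_congr rfl fun k _ => ?_
      rw [← add_mul]
      congr 1
      omega
    have hdvd : den ∣ num := by
      refine dvd_of_multiplicity_le den0 num0 fun q hq => ?_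
      obtain ⟨p, e, hpe⟩ := hv q hq
      have h1 := hsum q hq
      rw [Finset.sum_congr rfl (g := fun k => moebius (n / k) *
        ((if p ∣ k then e else 0 : ℕ) : ℤ)) fun k hk => by
          rw [hpe k (Nat.pos_of_mem_divisors hk)], sum_divisors_moebius_mul p e hn] at h1
      omega
    obtain ⟨g, hg⟩ := hdvd
    have g0 : g ≠ 0 := by rintro rfl; exact num0 (by rw [hg, mul_zero])
    refine ⟨g, g0, ?_, fun q hq => ?_⟩
    · have h2 := congrArg (algebraMap R K) hg
      have den0' : algebraMap R K den ≠ 0 := by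
        simpa using (map_ne_zero_iff _ hinj).2 den0
      rw [map_mul, hnum] at h2
      apply mul_left_cancel₀ den0'
      rw [← h2, hden, map_prod, map_prod, ← Finset.prod_mul_distrib]
      refine Finset.prod_congr rfl fun k hk => ?_
      have hk0 : algebraMap R K (b k) ≠ 0 := (map_ne_zero_iff _ hinj).2 (hbk k hk)
      rw [map_pow, map_pow, ← zpow_natCast, ← zpow_natCast, ← zpow_add₀ hk0]
      congr 1
      omega
    · have h1 := hsum q hq
      rw [hg, multiplicity_mul hq (.of_prime_left hq (mul_ne_zero den0 g0))] at h1
      push_cast at h1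
      linarith
  choose! g hg0 hg hgv using main
  have hinv := (prod_eq_iff_prod_pow_moebius_eq_of_nonzero (R := K)
    (f := fun n => algebraMap R K (g n)) (g := fun n => algebraMap R K (b n))
    (fun n hn => (map_ne_zero_iff _ hinj).2 (hg0 n hn))
    (fun n hn => (map_ne_zero_iff _ hinj).2 (hb n hn))).2 fun n hn => by
      rw [hg n hn, Nat.prod_divisorsAntidiagonal' (f := fun i j =>
        algebraMap R K (b j) ^ moebius i)]
  refine ⟨g, fun n hn => ⟨hg0 n hn, hg n hn, hinj ?_, hgv n hn⟩⟩
  rw [map_prod]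
  exact hinv n hn

end MoebiusProduct

/-! ### Valuations along the critical orbit -/

/-- The map `x ↦ x ^ d + c` on the quotient of `ℤ[c]` by the ideal `I`. -/
noncomputable def fMod (d : ℕ) (I : Ideal ℤ[X]) (x : ℤ[X] ⧸ I) : ℤ[X] ⧸ I :=
  x ^ d + Ideal.Quotient.mk I X

lemma mk_iterate (d : ℕ) (I : Ideal ℤ[X]) (k : ℕ) (x : ℤ[X]) :
    Ideal.Quotient.mk I ((f d)^[k] x) = (fMod d I)^[k] (Ideal.Quotient.mk I x) := by
  have h : Function.Semiconj (Ideal.Quotient.mk I) (f d) (fMod d I) := by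
    intro x
    simp [f, fMod]
  exact (h.iterate_right k) x

lemma isPeriodicPt_fMod_iff_mem (d : ℕ) (I : Ideal ℤ[X]) (j k : ℕ) :
    Function.IsPeriodicPt (fMod d I) k (Ideal.Quotient.mk I (orbit d j)) ↔
      orbit d (j + k) - orbit d j ∈ I := by
  rw [Function.IsPeriodicPt, Function.IsFixedPt, ← mk_iterate, ← orbit_add, Ideal.Quotient.eq]

lemma orbit_mem_iff (d : ℕ) (I : Ideal ℤ[X]) (k : ℕ) :
    orbit d k ∈ I ↔ Function.minimalPeriod (fMod d I) 0 ∣ k := by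
  have h := isPeriodicPt_fMod_iff_mem d I 0 k
  rw [orbit_zero, map_zero, sub_zero, zero_add] at h
  rw [← h, Function.isPeriodicPt_iff_minimalPeriod_dvd]

lemma isPeriodicPt_fMod_iff (d : ℕ) (q : ℤ[X]) (j k : ℕ) :
    Function.IsPeriodicPt (fMod d (Ideal.span {q})) k
      (Ideal.Quotient.mk (Ideal.span {q}) (orbit d j)) ↔ q ∣ orbit d (j + k) - orbit d j := by
  rw [isPeriodicPt_fMod_iff_mem, Ideal.mem_span_singleton]

lemma dvd_orbit_iff (d : ℕ) (q : ℤ[X]) (k : ℕ) :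
    q ∣ orbit d k ↔ Function.minimalPeriod (fMod d (Ideal.span {q})) 0 ∣ k := by
  rw [← orbit_mem_iff, Ideal.mem_span_singleton]

lemma multiplicity_mul_of_not_dvd {q : ℤ[X]} (hq : Prime q) {x u : ℤ[X]} (hx : x ≠ 0)
    (hu : ¬ q ∣ u) : multiplicity q (x * u) = multiplicity q x := by
  have hu0 : u ≠ 0 := by rintro rfl; exact hu (dvd_zero _)
  rw [multiplicity_mul hq (.of_prime_left hq (mul_ne_zero hx hu0)), multiplicity_eq_zero.2 hu,
    add_zero]

lemma orbit_pow_dvd_sub (d : ℕ) {j : ℕ} (hj : 1 ≤ j) (x : ℤ[X]) :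
    x ^ d ∣ (f d)^[j] x - (f d)^[j] 0 := by
  obtain ⟨j, rfl⟩ := Nat.exists_eq_add_of_le' hj
  rw [Function.iterate_succ_apply, Function.iterate_succ_apply]
  refine dvd_trans ?_ (sub_dvd_iterate_sub d j _ _)
  rcases Nat.eq_zero_or_pos d with rfl | hd
  · simp
  · simp [f, hd.ne']

/-- Since `f` is critical at `0`, the terms `f^{pk}(0)` agree with `f^p(0)` up to a factor which is
congruent to `1` modulo `f^p(0)`. -/
lemma exists_orbit_mul_eq {d : ℕ} (hd : 2 ≤ d) {p : ℕ} (hp : 1 ≤ p) {k : ℕ} (hpk : p ∣ k)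
    (hk : 1 ≤ k) : ∃ t, orbit d k = orbit d p * (1 + orbit d p * t) := by
  obtain ⟨i, rfl⟩ := hpk
  obtain ⟨i, rfl⟩ := Nat.exists_eq_add_of_le' (Nat.pos_of_mul_pos_left hk)
  clear hk
  induction i with
  | zero => exact ⟨0, by simp⟩
  | succ i ih =>
    obtain ⟨t, ht⟩ := ih
    obtain ⟨w, hw⟩ := orbit_pow_dvd_sub d hp (orbit d (p * (i + 1)))
    have h1 : (f d)^[p] 0 = orbit d p := rfl
    rw [← orbit_add, h1, show p * (i + 1) + p = p * (i + 1 + 1) by ring] at hw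
    obtain ⟨e, rfl⟩ := Nat.exists_eq_add_of_le' hd
    refine ⟨orbit (e + 2) p ^ e * (1 + orbit (e + 2) p * t) ^ (e + 2) * w, ?_⟩
    rw [sub_eq_iff_eq_add.1 hw, ht, mul_pow, pow_add _ e 2]
    ring

/-- The critical orbit is a rigid divisibility sequence. -/
lemma multiplicity_orbit {d : ℕ} (hd : 2 ≤ d) {q : ℤ[X]} (hq : Prime q) :
    ∃ e : ℕ, ∀ k, 1 ≤ k → multiplicity q (orbit d k) =
      if Function.minimalPeriod (fMod d (Ideal.span {q})) 0 ∣ k then e else 0 := by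
  set p := Function.minimalPeriod (fMod d (Ideal.span {q})) 0 with hp
  refine ⟨multiplicity q (orbit d p), fun k hk => ?_⟩
  split_ifs with hpk
  · have hp1 : 1 ≤ p := Nat.pos_of_dvd_of_pos hpk hk
    have hqp : q ∣ orbit d p := (dvd_orbit_iff d q p).2 dvd_rfl
    obtain ⟨t, ht⟩ := exists_orbit_mul_eq hd hp1 hpk hk
    rw [ht, multiplicity_mul_of_not_dvd hq (orbit_monic hd hp1).ne_zero]
    intro h
    exact hq.not_isUnit (isUnit_of_dvd_one ((dvd_add_left (hqp.mul_right t)).1 h))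
  · exact multiplicity_eq_zero.2 fun h => hpk ((dvd_orbit_iff d q k).1 h)

/-- The valuations of the difference quotients at a prime `q` dividing `f^j(0)`: here `f^{j+k}(0)`
and `f^j(0)` have the same valuation and a much closer distance, so that `Phi d j k` behaves like
`d * f^j(0) ^ (d - 1)` if `q` divides `f^k(0)`. -/
lemma multiplicity_Phi_of_dvd_orbit {d : ℕ} (hd : 2 ≤ d) {q : ℤ[X]} (hq : Prime q)
    (hqd : ¬ q ∣ (d : ℤ[X])) {j : ℕ} (hqj : q ∣ orbit d j) {k : ℕ} (hk : 1 ≤ k) :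
    multiplicity q (Phi d j k) = (d - 1) * multiplicity q (orbit d k) := by
  rcases Nat.eq_zero_or_pos j with rfl | hj
  · rw [Phi_zero hd, (FiniteMultiplicity.of_prime_left hq
      (orbit_monic hd hk).ne_zero).multiplicity_pow hq]
  by_cases hqk : q ∣ orbit d k
  · obtain ⟨e, he⟩ := multiplicity_orbit hd hq
    have hpj := (dvd_orbit_iff d q j).1 hqj
    have hpk := (dvd_orbit_iff d q k).1 hqk
    have hej := he j hj
    have hek := he k hk
    rw [if_pos hpj] at hej
    rw [if_pos hpk] at hek
    have he1 : 1 ≤ e := by rw [← hek]; exact multiplicity_pos_of_dvd hqk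
    obtain ⟨y, hy, hqy⟩ := (FiniteMultiplicity.of_prime_left hq
      (orbit_monic hd hj).ne_zero).exists_eq_pow_mul_and_not_dvd
    obtain ⟨z, hz⟩ := pow_multiplicity_dvd q (orbit d k)
    rw [hej] at hy
    rw [hek] at hz ⊢
    obtain ⟨w, hw⟩ := orbit_pow_dvd_sub d hj (orbit d k)
    have h1 : (f d)^[j] 0 = orbit d j := rfl
    rw [← orbit_add, h1, add_comm k j] at hw
    obtain ⟨r, hr⟩ := sub_dvd_Phi_sub d j k
    obtain ⟨e', rfl⟩ := Nat.exists_eq_add_of_le' he1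
    obtain ⟨d', rfl⟩ := Nat.exists_eq_add_of_le' (show 1 ≤ d by omega)
    have h2 : Phi (d' + 1) j k = q ^ ((d' + 1 - 1) * (e' + 1)) *
        (((d' + 1 : ℕ) : ℤ[X]) * y ^ d' + q * (q ^ e' * z ^ (d' + 1) * w * r)) := by
      rw [sub_eq_iff_eq_add.1 hr, hw, hz, hy]
      simp only [Nat.add_sub_cancel]
      rw [mul_pow, mul_pow, ← pow_mul, ← pow_mul]
      ring
    rw [h2, multiplicity_mul_of_not_dvd hq (pow_ne_zero _ hq.ne_zero),
      multiplicity_pow_self_of_prime hq]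
    intro h
    rcases hq.dvd_or_dvd ((dvd_add_left (dvd_mul_right _ _)).1 h) with h | h
    · exact hqd h
    · exact hqy (hq.dvd_of_dvd_pow h)
  · rw [multiplicity_eq_zero.2 hqk, mul_zero, multiplicity_eq_zero]
    intro h
    have h1 := (h.mul_right (orbit d (j + k) - orbit d j))
    rw [Phi_mul, show j + 1 + k = j + k + 1 by ring, orbit_succ, orbit_succ, add_sub_add_right_eq_sub,
      dvd_sub_left (dvd_pow hqj (by omega))] at h1
    have h2 := hq.dvd_of_dvd_pow h1
    rw [dvd_orbit_iff] at h2 hqk hqj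
    exact hqk ((Nat.dvd_add_right hqj).1 h2)

/-- The valuations of the difference quotients at a prime `q` not dividing `f^j(0)`. If `f^{j+1}(0)`
is periodic modulo `q` and `f^j(0)` is not, the multiplier of the cycle is divisible by `d`. As `d`
and `q` generate a proper ideal, `1` plus a multiple of the multiplier is not divisible by `q`; hence
the valuation does not grow along the multiples of the period. -/
lemma multiplicity_Phi_of_not_dvd_orbit {d : ℕ} (hd : 2 ≤ d) {q : ℤ[X]} (hq : Prime q)
    (hqd : ¬ q ∣ (d : ℤ[X])) (hcop : ¬ IsCoprime (d : ℤ[X]) q) {j : ℕ} (hqj : ¬ q ∣ orbit d j) :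
    ∃ p e : ℕ, ∀ k, 1 ≤ k → multiplicity q (Phi d j k) = if p ∣ k then e else 0 := by
  set z := Ideal.Quotient.mk (Ideal.span {q}) (orbit d j) with hz
  set w := Ideal.Quotient.mk (Ideal.span {q}) (orbit d (j + 1)) with hw
  have hzw : fMod d (Ideal.span {q}) z = w := by
    rw [hz, hw, orbit_add]
    exact (mk_iterate d _ 1 _).symm
  by_cases hper : z ∈ Function.periodicPts (fMod d (Ideal.span {q}))
  · refine ⟨0, 0, fun k _ => ?_⟩
    rw [ite_self, multiplicity_eq_zero]
    intro h
    have h1 := h.mul_right (orbit d (j + k) - orbit d j)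
    rw [Phi_mul, ← isPeriodicPt_fMod_iff, ← hw, Function.isPeriodicPt_iff_minimalPeriod_dvd,
      ← hzw, Function.minimalPeriod_apply hper, ← Function.isPeriodicPt_iff_minimalPeriod_dvd,
      isPeriodicPt_fMod_iff] at h1
    have h2 := (dvd_sub_right h).1 (h1.trans (sub_dvd_Phi_sub d j k))
    rcases hq.dvd_or_dvd h2 with h | h
    · exact hqd h
    · exact hqj (hq.dvd_of_dvd_pow h)
  · set p := Function.minimalPeriod (fMod d (Ideal.span {q})) w with hp
    refine ⟨p, multiplicity q (orbit d (j + 1 + p) - orbit d (j + 1)), fun k hk => ?_⟩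
    have hk1 : multiplicity q (Phi d j k) =
        multiplicity q (orbit d (j + 1 + k) - orbit d (j + 1)) := by
      rw [← Phi_mul, multiplicity_mul_of_not_dvd hq (Phi_monic hd j hk).ne_zero]
      rw [← isPeriodicPt_fMod_iff]
      exact fun h => hper ⟨k, hk, h⟩
    have hdvd : ∀ k, q ∣ orbit d (j + 1 + k) - orbit d (j + 1) ↔ p ∣ k := by
      intro k
      rw [← isPeriodicPt_fMod_iff, ← hw, Function.isPeriodicPt_iff_minimalPeriod_dvd]
    rw [hk1]
    split_ifs with hpk
    · have hp1 : 1 ≤ p := Nat.pos_of_dvd_of_pos hpk hk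
      obtain ⟨r, hr⟩ := (hdvd p).2 dvd_rfl
      have main : ∀ i : ℕ, ∃ s t, orbit d (j + 1 + p * (i + 1)) - orbit d (j + 1) =
          (orbit d (j + 1 + p) - orbit d (j + 1)) * (1 + d * s + q * t) := by
        intro i
        induction i with
        | zero => exact ⟨0, 0, by simp⟩
        | succ i ih =>
          obtain ⟨s, t, ht⟩ := ih
          obtain ⟨s', t', h⟩ := iterate_sub_iterate (d := d) hp1 (orbit d (j + 1 + p * (i + 1)))
            (orbit d (j + 1))
          rw [← orbit_add, ← orbit_add, ht] at h
          refine ⟨(1 + d * s + q * t) * s', r * (1 + d * s + q * t) ^ 2 * t', ?_⟩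
          rw [show j + 1 + p * (i + 1 + 1) = j + 1 + p * (i + 1) + p by ring]
          linear_combination h + (orbit d (j + 1 + p) - orbit d (j + 1)) *
            (1 + d * s + q * t) ^ 2 * t' * hr
      obtain ⟨i, rfl⟩ := hpk
      obtain ⟨i, rfl⟩ := Nat.exists_eq_add_of_le' (Nat.pos_of_mul_pos_left hk)
      obtain ⟨s, t, ht⟩ := main i
      rw [ht, multiplicity_mul_of_not_dvd hq (orbit_sub_monic hd _ hp1).ne_zero]
      rintro ⟨u, hu⟩
      exact hcop ⟨-s, u - t, by linear_combination -hu⟩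
    · exact multiplicity_eq_zero.2 fun h => hpk ((hdvd k).1 h)

lemma not_dvd_and_not_isCoprime_of_dvd_monic {d : ℕ} (hd : 2 ≤ d) {q P : ℤ[X]} (hq : ¬ IsUnit q)
    (hP : P.Monic) (hqP : q ∣ P) : ¬ q ∣ (d : ℤ[X]) ∧ ¬ IsCoprime (d : ℤ[X]) q := by
  have hlc : IsUnit q.leadingCoeff := by
    obtain ⟨r, rfl⟩ := hqP
    rw [Monic, leadingCoeff_mul] at hP
    exact IsUnit.of_mul_eq_one _ hP
  have hdeg : q.natDegree ≠ 0 := by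
    intro h
    rw [eq_C_of_natDegree_eq_zero h] at hq
    rw [leadingCoeff, h] at hlc
    exact hq (hlc.map C)
  constructor
  · intro h
    have h1 := natDegree_le_of_dvd h (by exact_mod_cast (show d ≠ 0 by omega))
    rw [natDegree_natCast] at h1
    omega
  · rintro ⟨s, t, hst⟩
    have : Fact (1 < d) := ⟨hd⟩
    have h1 := congrArg (Polynomial.map (Int.castRingHom (ZMod d))) hst
    simp only [Polynomial.map_add, Polynomial.map_mul, Polynomial.map_natCast, Polynomial.map_one] at h1
    rw [← C_eq_natCast, ZMod.natCast_self, C_0, mul_zero, zero_add] at h1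
    have hlc' := hlc.map (Int.castRingHom (ZMod d))
    have h2 : (q.map (Int.castRingHom (ZMod d))).natDegree = q.natDegree :=
      natDegree_map_of_leadingCoeff_ne_zero _ hlc'.ne_zero
    have h4 : IsUnit (q.map (Int.castRingHom (ZMod d))).leadingCoeff := by
      rwa [leadingCoeff_map_of_leadingCoeff_ne_zero _ hlc'.ne_zero]
    have h3 : (t.map (Int.castRingHom (ZMod d)) * q.map (Int.castRingHom (ZMod d))).natDegree = 0 := by
      rw [h1, natDegree_one]
    have ht0 : t.map (Int.castRingHom (ZMod d)) ≠ 0 := by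
      intro h; rw [h, zero_mul] at h1; exact zero_ne_one h1
    rw [natDegree_mul', h2] at h3
    · omega
    · rw [Ne, h4.mul_left_eq_zero]
      exact leadingCoeff_ne_zero.2 ht0

lemma exists_multiplicity_orbit {d : ℕ} (hd : 2 ≤ d) {q : ℤ[X]} (hq : Prime q) :
    ∃ p e : ℕ, ∀ k, 1 ≤ k → multiplicity q (orbit d k) = if p ∣ k then e else 0 :=
  ⟨_, multiplicity_orbit hd hq⟩

lemma exists_multiplicity_Phi {d : ℕ} (hd : 2 ≤ d) (j : ℕ) {q : ℤ[X]} (hq : Prime q) :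
    ∃ p e : ℕ, ∀ k, 1 ≤ k → multiplicity q (Phi d j k) = if p ∣ k then e else 0 := by
  by_cases h : ∃ k, 1 ≤ k ∧ q ∣ Phi d j k
  · obtain ⟨k, hk, hqk⟩ := h
    obtain ⟨hqd, hcop⟩ := not_dvd_and_not_isCoprime_of_dvd_monic hd hq.not_isUnit
      (Phi_monic hd j hk) hqk
    by_cases hqj : q ∣ orbit d j
    · obtain ⟨p, e, he⟩ := exists_multiplicity_orbit hd hq
      refine ⟨p, (d - 1) * e, fun k hk => ?_⟩
      rw [multiplicity_Phi_of_dvd_orbit hd hq hqd hqj hk, he k hk, mul_ite, mul_zero]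
    · exact multiplicity_Phi_of_not_dvd_orbit hd hq hqd hcop hqj
  · push Not at h
    exact ⟨0, 0, fun k hk => by rw [ite_self]; exact multiplicity_eq_zero.2 (h k hk)⟩

/-! ### The polynomials `G_{d,0,n}` and `G_{d,m,n}` and their reductions -/

lemma monic_of_prod_divisors {g b : ℕ → ℤ[X]} (hb : ∀ n, 1 ≤ n → (b n).Monic)
    (h : ∀ n, 1 ≤ n → ∏ k ∈ n.divisors, g k = b n) (n : ℕ) (hn : 1 ≤ n) : (g n).Monic := by
  induction n using Nat.strong_induction_on with
  | _ n ih =>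
    have h1 := h n hn
    rw [← Nat.cons_self_properDivisors (by omega), Finset.prod_cons] at h1
    refine Monic.of_mul_monic_right (q := ∏ k ∈ n.properDivisors, g k) ?_ (h1 ▸ hb n hn)
    refine monic_prod_of_monic _ _ fun k hk => ?_
    exact ih k (Nat.mem_properDivisors.1 hk).2 (Nat.pos_of_mem_properDivisors hk)

lemma eq_of_prod_divisors {R : Type*} [CommRing R] [IsDomain R] {g g' : ℕ → R}
    (hg : ∀ n, 1 ≤ n → g n ≠ 0)
    (h : ∀ n, 1 ≤ n → ∏ k ∈ n.divisors, g k = ∏ k ∈ n.divisors, g' k) (n : ℕ) (hn : 1 ≤ n) :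
    g n = g' n := by
  induction n using Nat.strong_induction_on with
  | _ n ih =>
    have h1 := h n hn
    rw [← Nat.cons_self_properDivisors (by omega), Finset.prod_cons, Finset.prod_cons,
      Finset.prod_congr rfl fun k hk =>
        (ih k (Nat.mem_properDivisors.1 hk).2 (Nat.pos_of_mem_properDivisors hk)).symm] at h1
    refine mul_right_cancel₀ (Finset.prod_ne_zero_iff.2 fun k hk => ?_) h1
    exact hg k (Nat.pos_of_mem_properDivisors hk)

lemma mul_dvd_prod_divisors {R : Type*} [CommRing R] {g b : ℕ → R}
    (h : ∀ n, 1 ≤ n → ∏ k ∈ n.divisors, g k = b n) {n i : ℕ} (hn : 1 ≤ n) (hi : i ∣ n)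
    (hin : i ≠ n) : g n * b i ∣ b n := by
  rw [← h n hn, ← h i (Nat.pos_of_dvd_of_pos hi hn),
    ← Nat.cons_self_properDivisors (n := n) (by omega), Finset.prod_cons]
  refine mul_dvd_mul_left _ (Finset.prod_dvd_prod_of_subset _ _ _ fun k hk => ?_)
  have hk' := Nat.dvd_of_mem_divisors hk
  have hi' := Nat.le_of_dvd hn hi
  have := Nat.le_of_dvd (Nat.pos_of_dvd_of_pos hi hn) hk'
  exact Nat.mem_properDivisors.2 ⟨hk'.trans hi, by omega⟩

section Reduction

variable (d : ℕ) [Fact d.Prime]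

lemma squarefree_map_orbit {k : ℕ} (hk : 1 ≤ k) :
    Squarefree ((orbit d k).map (Int.castRingHom (ZMod d))) := by
  obtain ⟨k, rfl⟩ := Nat.exists_eq_add_of_le' hk
  apply Separable.squarefree
  rw [Polynomial.Separable, derivative_map, orbit_succ]
  simp only [derivative_add, derivative_pow, derivative_X, Polynomial.map_add,
    Polynomial.map_mul, map_natCast, Polynomial.map_natCast, Polynomial.map_one]
  rw [← C_eq_natCast, ZMod.natCast_self, C_0, zero_mul, zero_mul, zero_add]
  exact isCoprime_one_right

lemma map_orbit_sub (j k : ℕ) :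
    (orbit d (j + k) - orbit d j).map (Int.castRingHom (ZMod d)) =
      (orbit d k).map (Int.castRingHom (ZMod d)) ^ d ^ j := by
  induction j with
  | zero => simp [orbit_zero]
  | succ j ih =>
    rw [show j + 1 + k = j + k + 1 by ring, orbit_succ, orbit_succ, add_sub_add_right_eq_sub,
      Polynomial.map_sub, Polynomial.map_pow, Polynomial.map_pow, ← sub_pow_char,
      ← Polynomial.map_sub, ih, ← pow_mul, ← pow_succ]

/-- Modulo `d` the differences along the orbit are `d`-th powers of one another, so that the
difference quotients are powers of `f^k(0)`. -/
lemma map_Phi (j : ℕ) {k : ℕ} (hk : 1 ≤ k) :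
    (Phi d j k).map (Int.castRingHom (ZMod d)) =
      (orbit d k).map (Int.castRingHom (ZMod d)) ^ (d ^ j * (d - 1)) := by
  have hd : 2 ≤ d := (Fact.out : d.Prime).two_le
  have h := congrArg (Polynomial.map (Int.castRingHom (ZMod d))) (Phi_mul d j k)
  rw [Polynomial.map_mul, map_orbit_sub, map_orbit_sub] at h
  refine mul_right_cancel₀ (pow_ne_zero _ ((orbit_monic hd hk).map _).ne_zero) (h.trans ?_)
  rw [← pow_add]
  congr 1
  obtain ⟨e, rfl⟩ := Nat.exists_eq_add_of_le' (show 1 ≤ d by omega)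
  rw [Nat.add_sub_cancel]
  ring

end Reduction

lemma F_succ_eq {d : ℕ} (hd : 2 ≤ d) (j n : ℕ) :
    F d (j + 1) n = ∏ k ∈ n.divisors,
      algebraMap ℤ[X] (FractionRing ℤ[X]) (Phi d j k) ^ ArithmeticFunction.moebius (n / k) := by
  refine Finset.prod_congr rfl fun k hk => ?_
  congr 1
  have h0 : algebraMap ℤ[X] (FractionRing ℤ[X]) (orbit d (j + k) - orbit d j) ≠ 0 :=
    (map_ne_zero_iff _ (FaithfulSMul.algebraMap_injective _ _)).2
      (orbit_sub_monic hd j (Nat.pos_of_mem_divisors hk)).ne_zero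
  have h := congrArg (algebraMap ℤ[X] (FractionRing ℤ[X])) (Phi_mul d j k)
  rw [map_mul] at h
  rw [Nat.add_sub_cancel, a, a, a, a, ← map_sub, ← map_sub, ← h, mul_div_cancel_right₀ _ h0]

/-- `G_{d,0,n}` and `G_{d,j+1,n}` are monic integral polynomials, together with the divisibility
properties and the congruence `G_{d,j+1,n} ≡ G_{d,0,n} ^ M` modulo `d` that the factorization
argument needs. -/
theorem exists_polynomials (d j n : ℕ) [Fact d.Prime] (hj : 1 ≤ j) (hn : 1 ≤ n) :
    ∃ G₀ G₁ : ℤ[X],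
      algebraMap ℤ[X] (FractionRing ℤ[X]) G₀ = G d 0 n ∧
      algebraMap ℤ[X] (FractionRing ℤ[X]) G₁ = G d (j + 1) n ∧
      G₀.Monic ∧ G₁.Monic ∧ G₀ ∣ orbit d n ∧ G₁ ∣ Phi d j n ∧
      (∀ i, i ∣ n → i ≠ n → G₀ * orbit d i ∣ orbit d n) ∧
      (n ∣ j → ∀ q, Prime q → q ∣ G₁ → ¬ q ∣ orbit d n) ∧
      G₁.map (Int.castRingHom (ZMod d)) =
        G₀.map (Int.castRingHom (ZMod d)) ^ M d (j + 1) n := by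
  have hd : 2 ≤ d := (Fact.out : d.Prime).two_le
  have hinj := FaithfulSMul.algebraMap_injective ℤ[X] (FractionRing ℤ[X])
  obtain ⟨g, hg⟩ := exists_moebius_prod (FractionRing ℤ[X]) (orbit d)
    (fun k hk => (orbit_monic hd hk).ne_zero) (fun q hq => exists_multiplicity_orbit hd hq)
  obtain ⟨h, hh⟩ := exists_moebius_prod (FractionRing ℤ[X]) (Phi d j)
    (fun k hk => (Phi_monic hd j hk).ne_zero) (fun q hq => exists_multiplicity_Phi hd j hq)
  have hgprod := fun n hn => (hg n hn).2.2.1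
  have hhprod := fun n hn => (hh n hn).2.2.1
  have hgm := monic_of_prod_divisors (fun n hn => orbit_monic hd hn) hgprod
  have hhm := monic_of_prod_divisors (fun n hn => Phi_monic hd j hn) hhprod
  have hgG : algebraMap ℤ[X] (FractionRing ℤ[X]) (g n) = G d 0 n := by
    rw [(hg n hn).2.1, G, if_pos rfl]
    rfl
  have hhF : algebraMap ℤ[X] (FractionRing ℤ[X]) (h n) = F d (j + 1) n := by
    rw [(hh n hn).2.1, F_succ_eq hd]
  have hF1 : algebraMap ℤ[X] (FractionRing ℤ[X]) (g n ^ (d - 1)) = F d 1 n := by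
    rw [map_pow, (hg n hn).2.1, F_succ_eq hd 0, ← Finset.prod_pow]
    refine Finset.prod_congr rfl fun k _ => ?_
    rw [Phi_zero hd, map_pow, ← zpow_natCast, ← zpow_natCast, zpow_comm]
  have hgdvd : g n ∣ orbit d n := by
    rw [← hgprod n hn]
    exact Finset.dvd_prod_of_mem _ (Nat.mem_divisors_self n (by omega))
  have hhdvd : h n ∣ Phi d j n := by
    rw [← hhprod n hn]
    exact Finset.dvd_prod_of_mem _ (Nat.mem_divisors_self n (by omega))
  have hmap : (h n).map (Int.castRingHom (ZMod d)) =
      (g n).map (Int.castRingHom (ZMod d)) ^ (d ^ j * (d - 1)) := by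
    refine eq_of_prod_divisors (g := fun n => (h n).map (Int.castRingHom (ZMod d)))
      (g' := fun n => (g n).map (Int.castRingHom (ZMod d)) ^ (d ^ j * (d - 1)))
      (fun n hn => ((hhm n hn).map _).ne_zero) (fun n hn => ?_) n hn
    rw [Finset.prod_pow, ← Polynomial.map_prod, ← Polynomial.map_prod, hgprod n hn, hhprod n hn,
      map_Phi d j hn]
  have hsub := fun i (hi : i ∣ n) (hin : i ≠ n) => mul_dvd_prod_divisors hgprod hn hi hin
  by_cases hnj : n ∣ j
  · -- A prime dividing `f^n(0)` divides `F_{d,j+1,n}` exactly as often as `F_{d,1,n}`.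
    have hval : ∀ q : ℤ[X], Prime q → q ∣ orbit d n →
        multiplicity q (h n) = multiplicity q (g n ^ (d - 1)) := by
      intro q hq hqn
      have hqj : q ∣ orbit d j := by
        rw [dvd_orbit_iff] at hqn ⊢
        exact hqn.trans hnj
      have hqd := (not_dvd_and_not_isCoprime_of_dvd_monic hd hq.not_isUnit
        (orbit_monic hd hn) hqn).1
      rw [(FiniteMultiplicity.of_prime_left hq (hg n hn).1).multiplicity_pow hq]
      zify
      rw [(hh n hn).2.2.2 q hq, (hg n hn).2.2.2 q hq, Finset.mul_sum]
      refine Finset.sum_congr rfl fun k hk => ?_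
      rw [multiplicity_Phi_of_dvd_orbit hd hq hqd hqj (Nat.pos_of_mem_divisors hk)]
      push_cast
      ring
    have hpow0 : g n ^ (d - 1) ≠ 0 := pow_ne_zero _ (hg n hn).1
    obtain ⟨G₁, hG₁⟩ : g n ^ (d - 1) ∣ h n := by
      refine dvd_of_multiplicity_le hpow0 (hh n hn).1 fun q hq => ?_
      by_cases hqn : q ∣ orbit d n
      · exact (hval q hq hqn).ge
      · rw [multiplicity_eq_zero.2 fun hc => hqn ((hq.dvd_of_dvd_pow hc).trans hgdvd)]
        exact Nat.zero_le _
    refine ⟨g n, G₁, hgG, ?_, hgm n hn, ?_, hgdvd, ?_, hsub, ?_, ?_⟩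
    · rw [G, if_neg (by omega), Nat.add_sub_cancel, if_pos hnj, ← hF1, ← hhF, hG₁, map_mul,
        mul_div_cancel_left₀ _ ((map_ne_zero_iff _ hinj).2 hpow0)]
    · exact ((hgm n hn).pow (d - 1)).of_mul_monic_left (hG₁ ▸ hhm n hn)
    · exact (Dvd.intro_left _ hG₁.symm).trans hhdvd
    · intro _ q hq hqG hqn
      have h1 := hval q hq hqn
      rw [hG₁, multiplicity_mul hq (.of_prime_left hq (hG₁ ▸ (hh n hn).1))] at h1
      have := multiplicity_pos_of_dvd hqG
      omega
    · have h1 := hmap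
      rw [hG₁, Polynomial.map_mul, Polynomial.map_pow] at h1
      refine mul_left_cancel₀ (pow_ne_zero _ ((hgm n hn).map _).ne_zero) (h1.trans ?_)
      rw [← pow_add, M, Nat.add_sub_cancel, if_pos hnj]
      congr 1
      have := Nat.one_le_pow j d (by omega)
      obtain ⟨e, he⟩ := Nat.exists_eq_add_of_le' this
      rw [he, Nat.add_sub_cancel]
      ring
  · refine ⟨g n, h n, hgG, ?_, hgm n hn, hhm n hn, hgdvd, hhdvd, hsub,
      fun hc => absurd hc hnj, ?_⟩
    · rw [G, if_neg (by omega), Nat.add_sub_cancel, if_neg hnj, hhF]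
    · rw [hmap, M, Nat.add_sub_cancel, if_neg hnj]

/-! ### A lower bound for the valuation of `d` -/

/-- A prime `q` of `ℤ[c]` and a proper ideal `p` containing it give a valuation with support
generated by `q`, which is less than `1` on `p`: take a valuation ring of the fraction field of
`ℤ[c] / (q)` dominating the image of `ℤ[c]` localized at a maximal ideal above `p`. It need not be
discrete, which makes the integral closure of `ℤ[c] / (q)` unnecessary. -/
lemma exists_valuation {q : ℤ[X]} (hq : Prime q) {p : Ideal ℤ[X]} (hp : p ≠ ⊤) (hqp : q ∈ p) :
    ∃ (Γ : Type) (_ : LinearOrderedCommGroupWithZero Γ) (v : Valuation ℤ[X] Γ),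
      (∀ x, v x ≤ 1) ∧ (∀ x ∈ p, v x < 1) ∧ ∀ x, v x = 0 ↔ q ∣ x := by
  have hprime : (Ideal.span {q}).IsPrime := (Ideal.span_singleton_prime hq.ne_zero).2 hq
  let K := FractionRing (ℤ[X] ⧸ Ideal.span {q})
  let φ : ℤ[X] →+* K := (algebraMap (ℤ[X] ⧸ Ideal.span {q}) K).comp (Ideal.Quotient.mk _)
  have hφ : ∀ x, φ x = 0 ↔ q ∣ x := by
    intro x
    rw [RingHom.comp_apply, map_eq_zero_iff _ (FaithfulSMul.algebraMap_injective _ _),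
      Ideal.Quotient.eq_zero_iff_mem, Ideal.mem_span_singleton]
  have hker : RingHom.ker φ.rangeRestrict ≤ p := by
    intro x hx
    rw [RingHom.ker_rangeRestrict, RingHom.mem_ker, hφ] at hx
    obtain ⟨r, rfl⟩ := hx
    exact p.mul_mem_right _ hqp
  have hI : p.map φ.rangeRestrict ≠ ⊤ := by
    rwa [Ne, Ideal.map_eq_top_iff_of_ker_le _ hker
      (RingHom.isIntegral_of_surjective _ φ.rangeRestrict_surjective)]
  obtain ⟨B, hB, hIB⟩ := Ideal.image_subset_nonunits_valuationSubring _ hI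
  refine ⟨B.ValueGroup, inferInstance, B.valuation.comap φ, fun x => ?_, fun x hx => ?_,
    fun x => ?_⟩
  · rw [Valuation.comap_apply, ValuationSubring.valuation_le_one_iff]
    exact hB (φ.mem_range_self x)
  · rw [Valuation.comap_apply, ← ValuationSubring.mem_nonunits_iff]
    exact hIB ⟨_, Ideal.mem_map_of_mem _ hx, rfl⟩
  · rw [Valuation.comap_apply, Valuation.zero_iff, hφ]

section

variable {R Γ : Type*} [CommRing R] [LinearOrderedCommGroupWithZero Γ] {v : Valuation R Γ} {d : ℕ}

lemma pow_sub_pow_eq (hd : d.Prime) (x y : R) :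
    x ^ d - y ^ d = (x - y) ^ d + d * (x - y) * y * ∑ k ∈ Finset.Ioo 0 d,
      (x - y) ^ (k - 1) * y ^ (d - k - 1) * ((d.choose k / d : ℕ) : R) := by
  have h := add_pow_prime_eq hd (x - y) y
  rw [sub_add_cancel] at h
  linear_combination h

lemma valuation_pow_sub_pow_le (hd : d.Prime) (hv : ∀ x, v x ≤ 1) (x y : R) :
    v (x ^ d - y ^ d) ≤ max (v (x - y) ^ d) (v d * v (x - y)) := by
  rw [pow_sub_pow_eq hd, ← map_pow, ← map_mul]
  refine (v.map_add _ _).trans (max_le_max le_rfl ?_)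
  rw [mul_assoc _ y, map_mul]
  exact mul_le_of_le_one_right' (hv _)

/-- The model case is `x = ζ * y` with a primitive `d`-th root of unity `ζ`, where `s` is the sum of
the `x ^ i * y ^ (d - 1 - i)` and the bound says that `d` divides `(ζ - 1) ^ (d - 1)` up to a unit.
Valuation zero stands for vanishing, since `v` may have a nontrivial support. -/
lemma valuation_mul_le_of_geom_sum (hd : d.Prime) (hv : ∀ x, v x ≤ 1) {x y s : R}
    (hs : v s = 0) (hxy : s * (x - y) = x ^ d - y ^ d) (hdvd : x - y ∣ s - d * y ^ (d - 1))
    (hlt : v (x - y) < v y) : v d * v y ^ (d - 1) ≤ v (x - y) ^ (d - 1) := by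
  obtain ⟨e, rfl⟩ := Nat.exists_eq_add_of_le' hd.two_le
  have hy0 : v y ≠ 0 := (zero_le.trans_lt hlt).ne'
  by_cases hδ : v (x - y) = 0
  · obtain ⟨r, hr⟩ := hdvd
    have h1 : ((e + 2 : ℕ) : R) * y ^ (e + 2 - 1) = s - (x - y) * r := by rw [← hr]; ring
    rw [← map_pow, ← map_mul, h1]
    refine (v.map_sub _ _).trans ?_
    simp [hs, hδ]
  set S := ∑ k ∈ Finset.Ioo 0 (e + 2),
      (x - y) ^ (k - 1) * y ^ (e + 2 - k - 1) * (((e + 2).choose k / (e + 2) : ℕ) : R) with hS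
  have hvS : v S = v y ^ e := by
    have hsplit : Finset.Ioo 0 (e + 2) = insert 1 (Finset.Ioo 1 (e + 2)) := by
      ext k; simp only [Finset.mem_Ioo, Finset.mem_insert]; omega
    rw [hS, hsplit, Finset.sum_insert (by simp), ← map_pow]
    simp only [Nat.sub_self, pow_zero, one_mul, Nat.choose_one_right,
      Nat.div_self (show 0 < e + 2 by omega), Nat.cast_one, mul_one,
      show e + 2 - 1 - 1 = e by omega]
    apply Valuation.map_add_eq_of_lt_left
    rw [map_pow]
    refine v.map_sum_lt (pow_ne_zero _ hy0) fun k hk => ?_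
    rw [Finset.mem_Ioo] at hk
    rw [map_mul, map_mul, map_pow, map_pow]
    refine (mul_le_of_le_one_right' (hv _)).trans_lt ?_
    have h1 : v y ^ e = v y ^ (k - 1) * v y ^ (e + 2 - k - 1) := by
      rw [← pow_add]; congr 1; omega
    rw [h1]
    exact mul_lt_mul_of_pos_right (pow_lt_pow_left₀ hlt zero_le (by omega))
      (zero_lt_iff.2 (pow_ne_zero _ hy0))
  have h1 : v ((x - y) ^ (e + 2) + ((e + 2 : ℕ) : R) * (x - y) * y * S) = 0 := by
    rw [hS, ← pow_sub_pow_eq hd, ← hxy, map_mul, hs, zero_mul]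
  have h2 : v ((x - y) ^ (e + 2)) = v (((e + 2 : ℕ) : R) * (x - y) * y * S) := by
    by_contra hne
    rw [Valuation.map_add_of_distinct_val _ hne] at h1
    apply hne
    rw [le_antisymm ((le_max_left _ _).trans h1.le) zero_le,
      le_antisymm ((le_max_right _ _).trans h1.le) zero_le]
  rw [map_pow, map_mul, map_mul, map_mul, hvS] at h2
  refine le_of_eq (mul_right_cancel₀ hδ ?_)
  rw [show e + 2 - 1 = e + 1 by omega, ← pow_succ, h2, pow_succ]
  ac_rfl

end

/-- If `Phi d j n` lies in the support of `v`, then `d` is divisible, with respect to `v`, by the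
`M`-th power of `f^n(0)`. The differences `δ i = f^{i+n}(0) - f^i(0)` satisfy
`v (δ (i + 1)) ≤ max (v (δ i) ^ d) (v d * v (δ i))`. If the second term were larger for some
`i < j`, the final difference `δ j` would be too small compared with `d`. -/
lemma valuation_natCast_le {Γ : Type*} [LinearOrderedCommGroupWithZero Γ] {v : Valuation ℤ[X] Γ}
    {d : ℕ} (hd : d.Prime) (hv : ∀ x, v x ≤ 1) {j n : ℕ} (hj : 1 ≤ j) (hn : 1 ≤ n)
    (hd0 : v d ≠ 0) (hlt : v (orbit d n) < 1) (hPhi : v (Phi d j n) = 0)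
    (h0 : n ∣ j → v (orbit d n) ≠ 0) (h1 : ¬ n ∣ j → v (orbit d j) = 1) :
    v d ≤ v (orbit d n) ^ M d (j + 1) n := by
  have hd2 := hd.two_le
  set α := v (orbit d n) with hα
  have hβ : v (orbit d j) = if n ∣ j then α else 1 := by
    split_ifs with hnj
    · obtain ⟨t, ht⟩ := exists_orbit_mul_eq hd2 hn hnj hj
      have h2 : v (orbit d n * t) < 1 := by
        rw [map_mul]
        exact (mul_le_of_le_one_right' (hv _)).trans_lt hlt
      rw [ht, map_mul, v.map_one_add_of_lt h2, mul_one]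
    · exact h1 hnj
  set β := v (orbit d j) with hβdef
  set δ : ℕ → ℤ[X] := fun i => orbit d (i + n) - orbit d i with hδ
  have hδ0 : v (δ 0) = α := by simp [hδ, orbit_zero, hα]
  have hδ1 : v (δ 1) = α ^ d := by
    have : δ 1 = orbit d n ^ d := by
      simp only [hδ]
      rw [add_comm 1 n, orbit_succ, ← zero_add 1, orbit_succ, orbit_zero,
        zero_pow (by omega)]
      ring
    rw [this, map_pow]
  have hsucc : ∀ i, δ (i + 1) = orbit d (i + n) ^ d - orbit d i ^ d := by
    intro i
    simp only [hδ]
    rw [show i + 1 + n = i + n + 1 by ring, orbit_succ, orbit_succ]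
    ring
  have hstep : ∀ i, v (δ (i + 1)) ≤ max (v (δ i) ^ d) (v d * v (δ i)) := by
    intro i
    rw [hsucc]
    exact valuation_pow_sub_pow_le hd hv _ _
  have hanti : Antitone fun i => v (δ i) := by
    refine antitone_nat_of_succ_le fun i => ?_
    rw [hsucc]
    obtain ⟨r, hr⟩ := sub_dvd_pow_sub_pow (orbit d (i + n)) (orbit d i) d
    rw [hr, map_mul]
    exact mul_le_of_le_one_right' (hv _)
  have hδβ : ∀ i, 1 ≤ i → v (δ i) < β := by
    intro i hi
    refine (hanti hi).trans_lt ?_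
    simp only
    rw [hδ1, hβ]
    split_ifs with hnj
    · exact pow_lt_self_of_lt_one₀ (zero_lt_iff.2 (h0 hnj)) hlt (by omega)
    · exact pow_lt_one₀ zero_le hlt (by omega)
  have hβpos : 0 < β := zero_le.trans_lt (hδβ 1 le_rfl)
  have hkey : v d * β ^ (d - 1) ≤ v (δ j) ^ (d - 1) := by
    refine valuation_mul_le_of_geom_sum hd hv hPhi ?_ (sub_dvd_Phi_sub d j n) (hδβ j hj)
    rw [Phi_mul]
    exact hsucc j
  have hclaim : ∀ i, i ≤ j → v (δ i) ≤ α ^ d ^ i := by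
    intro i
    induction i with
    | zero => intro _; rw [hδ0, pow_zero, pow_one]
    | succ i ih =>
      intro hij
      rcases Nat.eq_zero_or_pos i with rfl | hi
      · rw [zero_add, hδ1, pow_one]
      rcases le_or_gt (v (d : ℤ[X])) (v (δ i) ^ (d - 1)) with hle | hgt
      · refine (hstep i).trans (max_le ?_ ?_)
        · rw [pow_succ, pow_mul]
          exact pow_le_pow_left₀ zero_le (ih (by omega)) _
        · calc v (d : ℤ[X]) * v (δ i) ≤ v (δ i) ^ (d - 1) * v (δ i) := mul_le_mul_left hle _
            _ = v (δ i) ^ d := by rw [← pow_succ, Nat.sub_add_cancel (by omega)]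
            _ ≤ (α ^ d ^ i) ^ d := pow_le_pow_left₀ zero_le (ih (by omega)) _
            _ = α ^ d ^ (i + 1) := by rw [pow_succ, pow_mul]
      · exfalso
        have h2 : v (δ (i + 1)) ≤ v d * v (δ i) := by
          refine (hstep i).trans (max_le ?_ le_rfl)
          calc v (δ i) ^ d = v (δ i) ^ (d - 1) * v (δ i) := by
                rw [← pow_succ, Nat.sub_add_cancel (by omega)]
            _ ≤ v d * v (δ i) := mul_le_mul_left hgt.le _
        have h3 : v (δ j) ≤ v d * v (δ i) := (hanti hij).trans h2
        have h4 : v d * β ^ (d - 1) < v d * β ^ (d - 1) := by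
          calc v d * β ^ (d - 1) ≤ (v d * v (δ i)) ^ (d - 1) :=
                hkey.trans (pow_le_pow_left₀ zero_le h3 _)
            _ = v d ^ (d - 1) * v (δ i) ^ (d - 1) := mul_pow _ _ _
            _ < v d ^ (d - 1) * β ^ (d - 1) :=
                mul_lt_mul_of_pos_left (pow_lt_pow_left₀ (hδβ i hi) zero_le (by omega))
                  (zero_lt_iff.2 (pow_ne_zero _ hd0))
            _ ≤ v d * β ^ (d - 1) :=
                mul_le_mul_left (pow_le_of_le_one zero_le (hv _) (by omega)) _
        exact lt_irrefl _ h4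
  have hfin : v d * β ^ (d - 1) ≤ α ^ (d ^ j * (d - 1)) := by
    rw [pow_mul]
    exact hkey.trans (pow_le_pow_left₀ zero_le (hclaim j le_rfl) _)
  rw [M, Nat.add_sub_cancel]
  split_ifs with hnj
  · rw [if_pos hnj] at hβ
    have h2 : d ^ j * (d - 1) = (d ^ j - 1) * (d - 1) + (d - 1) := by
      obtain ⟨e, he⟩ := Nat.exists_eq_add_of_le' (Nat.one_le_pow j d (by omega))
      rw [he, Nat.add_sub_cancel]
      ring
    rw [h2, pow_add, hβ] at hfin
    exact le_of_mul_le_mul_right hfin (zero_lt_iff.2 (pow_ne_zero _ (h0 hnj)))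
  · rwa [hβ, if_neg hnj, one_pow, mul_one] at hfin

/-! ### Irreducible factors -/

open UniqueFactorizationMonoid

lemma exists_natCast_mul_eq {d : ℕ} {x : ℤ[X]}
    (hx : x.map (Int.castRingHom (ZMod d)) = 0) : ∃ w : ℤ[X], x = d * w := by
  have h : C (d : ℤ) ∣ x := by
    rw [C_dvd_iff_dvd_coeff]
    intro i
    have h1 := congrArg (fun p => coeff p i) hx
    simpa [coeff_map, ZMod.intCast_zmod_eq_zero_iff_dvd] using h1
  exact h.imp fun w hw => by simpa using hw

lemma M_pos {d : ℕ} (hd : 2 ≤ d) {j : ℕ} (hj : 1 ≤ j) (n : ℕ) : 0 < M d (j + 1) n := by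
  have h : 2 ≤ d ^ j := hd.trans (Nat.le_self_pow (by omega) d)
  rw [M, Nat.add_sub_cancel]
  split_ifs <;> exact Nat.mul_pos (by omega) (by omega)

/-- An irreducible factor `π` of the reduction of an integral prime factor `H` of `G_{d,j+1,n}`
divides this reduction at least `M` times: writing `H ≡ π ^ e * h` modulo `d`, the element
`f^n(0) ^ e * h` is a multiple of `d` modulo `H`, hence of the `M`-th power of `f^n(0)` for a
valuation which is trivial on `h`. -/
lemma le_multiplicity_map {d j n : ℕ} [Fact d.Prime] (hj : 1 ≤ j) (hn : 1 ≤ n) {G₀ G₁ H : ℤ[X]}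
    (h0 : G₀ ∣ orbit d n) (h1 : G₁ ∣ Phi d j n)
    (hsub : ∀ i, i ∣ n → i ≠ n → G₀ * orbit d i ∣ orbit d n)
    (hnd : n ∣ j → ∀ q, Prime q → q ∣ G₁ → ¬ q ∣ orbit d n)
    (hmap : G₁.map (Int.castRingHom (ZMod d)) =
        G₀.map (Int.castRingHom (ZMod d)) ^ M d (j + 1) n)
    (hHm : H.Monic) (hH : Prime H) (hHG : H ∣ G₁) {π : (ZMod d)[X]} (hπ : Irreducible π)
    (hπH : π ∣ H.map (Int.castRingHom (ZMod d))) :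
    M d (j + 1) n ≤ multiplicity π (H.map (Int.castRingHom (ZMod d))) := by
  have hdp : d.Prime := Fact.out
  set r := mapRingHom (Int.castRingHom (ZMod d)) with hr
  have hsurj : Function.Surjective r := map_surjective _ (ZMod.ringHom_surjective _)
  have hπ0 : π ∣ r G₀ := by
    refine hπ.prime.dvd_of_dvd_pow (n := M d (j + 1) n) ?_
    rw [hr, coe_mapRingHom, ← hmap]
    exact hπH.trans (map_dvd r hHG)
  have hπn : π ∣ r (orbit d n) := hπ0.trans (map_dvd r h0)
  set p : Ideal ℤ[X] := (Ideal.span {π}).comap r with hp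
  have hmem : ∀ x, x ∈ p ↔ π ∣ r x := fun x => by
    rw [hp, Ideal.mem_comap, Ideal.mem_span_singleton]
  have hptop : p ≠ ⊤ := by
    rw [Ideal.ne_top_iff_one, hmem, map_one]
    exact fun h => hπ.not_isUnit (isUnit_of_dvd_one h)
  obtain ⟨Γ, _, v, hv, hvp, hv0⟩ := exists_valuation hH hptop ((hmem H).2 hπH)
  -- An element outside the maximal ideal `p` is a unit for the valuation.
  have hunit : ∀ x, ¬ π ∣ r x → v x = 1 := by
    intro x hx
    obtain ⟨s, t, hst⟩ := (hπ.coprime_iff_not_dvd).2 hx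
    obtain ⟨t, rfl⟩ := hsurj t
    by_contra hne
    have hlt : v (t * x) < 1 := by
      rw [map_mul]
      exact (mul_le_of_le_one_left' (hv _)).trans_lt (lt_of_le_of_ne (hv x) hne)
    have h2 : v (1 - t * x) < 1 := by
      refine hvp _ ((hmem _).2 ⟨s, ?_⟩)
      rw [map_sub, map_one, map_mul, ← hst]
      ring
    have h3 := v.map_add_lt h2 hlt
    rw [sub_add_cancel, map_one] at h3
    exact lt_irrefl _ h3
  have hd0 : v d ≠ 0 := by
    rw [Ne, hv0]
    exact (not_dvd_and_not_isCoprime_of_dvd_monic hdp.two_le hH.not_isUnit hHm dvd_rfl).1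
  have hαlt : v (orbit d n) < 1 := hvp _ ((hmem _).2 hπn)
  have hmain := valuation_natCast_le hdp hv hj hn hd0 hαlt ((hv0 _).2 (hHG.trans h1))
    (fun hnj => by rw [Ne, hv0]; exact hnd hnj H hH hHG) (fun hnj => by
      -- Otherwise `π` divides `f^i(0)` for the proper divisor `i = gcd(j, n)` of `n`, so that
      -- `π ^ 2` divides the reduction of `f^n(0)`.
      refine hunit _ fun hπj => ?_
      have h2 := (orbit_mem_iff d p j).1 ((hmem _).2 hπj)
      have h3 := (orbit_mem_iff d p n).1 ((hmem _).2 hπn)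
      have h4 := (hmem _).1 ((orbit_mem_iff d p _).2 (Nat.dvd_gcd h2 h3))
      have h5 := map_dvd r (hsub (j.gcd n) (Nat.gcd_dvd_right _ _)
        fun h => hnj (h ▸ Nat.gcd_dvd_left j n))
      rw [map_mul] at h5
      exact hπ.not_isUnit (squarefree_map_orbit d hn π ((mul_dvd_mul hπ0 h4).trans h5)))
  have hM := M_pos hdp.two_le hj n
  have hα0 : v (orbit d n) ≠ 0 := by
    intro h
    rw [h, zero_pow hM.ne'] at hmain
    exact hd0 (le_antisymm hmain zero_le)
  have hfin : FiniteMultiplicity π (r H) := .of_prime_left hπ.prime (hHm.map _).ne_zero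
  obtain ⟨h, hh, hπh⟩ := hfin.exists_eq_pow_mul_and_not_dvd
  change M d (j + 1) n ≤ multiplicity π (r H)
  set e := multiplicity π (r H)
  obtain ⟨h, rfl⟩ := hsurj h
  obtain ⟨b, hb⟩ := hπn
  obtain ⟨b, rfl⟩ := hsurj b
  obtain ⟨w, hw⟩ : ∃ w : ℤ[X], orbit d n ^ e * h - H * b ^ e = d * w := by
    apply exists_natCast_mul_eq
    rw [← coe_mapRingHom, ← hr, map_sub, map_mul, map_mul, map_pow, map_pow, hb, hh]
    ring
  have hvw : v (orbit d n) ^ e ≤ v d := by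
    have h2 : v (orbit d n ^ e * h) ≤ max (v (d * w)) (v (H * b ^ e)) := by
      rw [sub_eq_iff_eq_add.1 hw]
      exact v.map_add _ _
    rw [map_mul, map_pow, hunit h hπh, mul_one, map_mul, map_mul, (hv0 H).2 dvd_rfl, zero_mul,
      max_eq_left zero_le] at h2
    exact h2.trans (mul_le_of_le_one_right' (hv w))
  exact (pow_le_pow_iff_right_of_lt_one₀ (zero_lt_iff.2 hα0) hαlt).1 (hvw.trans hmain)

lemma exists_eq_pow_of_dvd_squarefree_pow {K : Type*} [Field K] {P G : K[X]} {N : ℕ}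
    (hP : P.Monic) (hG : Squarefree G) (hPG : P ∣ G ^ N)
    (h : ∀ π, Irreducible π → π ∣ P → N ≤ multiplicity π P) : ∃ A, P = A ^ N := by
  classical
  have hG0 : G ≠ 0 := hG.ne_zero
  have hnf : normalizedFactors P = N • (normalizedFactors P).dedup := by
    ext π
    rw [Multiset.count_nsmul, Multiset.count_dedup]
    split_ifs with hπ
    · have hirr := irreducible_of_normalized_factor π hπ
      have h1 := h π hirr (dvd_of_mem_normalizedFactors hπ)
      rw [multiplicity_eq_count_normalizedFactors hirr hP.ne_zero,
        normalize_normalized_factor π hπ] at h1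
      have h2 := (dvd_iff_normalizedFactors_le_normalizedFactors hP.ne_zero
        (pow_ne_zero N hG0)).1 hPG
      rw [normalizedFactors_pow] at h2
      have h3 := Multiset.count_le_of_le π h2
      rw [Multiset.count_nsmul] at h3
      have h4 := Multiset.nodup_iff_count_le_one.1
        ((squarefree_iff_nodup_normalizedFactors hG0).1 hG) π
      have h5 := Nat.mul_le_mul_left N h4
      omega
    · rw [mul_zero, Multiset.count_eq_zero.2 hπ]
  refine ⟨(normalizedFactors P).dedup.prod, ?_⟩
  rw [← Multiset.prod_nsmul, ← hnf, prod_normalizedFactors_eq hP.ne_zero, hP.normalize_eq_self]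

/-- If all irreducible factors of `G` reduce modulo `d` to `N`-th powers, then the reduction of `G`
has at least `N` times as many irreducible factors as `G`. -/
lemma card_mul_le_card_normalizedFactors {d : ℕ} [Fact d.Prime] {G : ℤ[X]} {N : ℕ}
    (h : ∀ H : ℤ[X], H.Monic → Irreducible (H.map (Int.castRingHom ℚ)) → H ∣ G →
      ∃ A : (ZMod d)[X], H.map (Int.castRingHom (ZMod d)) = A ^ N)
    (s : Multiset ℚ[X]) (hs : ∀ x ∈ s, x.Monic ∧ Irreducible x) (Q : ℤ[X]) (hQ : Q.Monic)
    (hQs : Q.map (Int.castRingHom ℚ) = s.prod) (hQG : Q ∣ G) :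
    s.card * N ≤ (normalizedFactors (Q.map (Int.castRingHom (ZMod d)))).card := by
  have hlift : ∀ x : ℚ[X], x.Monic → x ∣ Q.map (Int.castRingHom ℚ) →
      ∃ y : ℤ[X], y.Monic ∧ y.map (Int.castRingHom ℚ) = x := by
    intro x hx hxQ
    obtain ⟨y, hy⟩ := IsIntegrallyClosed.eq_map_mul_C_of_dvd ℚ hQ hxQ
    rw [hx.leadingCoeff, C_1, mul_one] at hy
    exact ⟨y, monic_of_injective (algebraMap ℤ ℚ).injective_int (hy ▸ hx), hy⟩
  induction s using Multiset.induction_on generalizing Q with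
  | empty => simp
  | cons x t ih =>
    rw [Multiset.prod_cons] at hQs
    have hx := hs x (Multiset.mem_cons_self x t)
    have ht : ∀ y ∈ t, y.Monic ∧ Irreducible y := fun y hy => hs y (Multiset.mem_cons_of_mem hy)
    obtain ⟨H, hHm, hH⟩ := hlift x hx.1 (Dvd.intro _ hQs.symm)
    obtain ⟨T, hTm, hT⟩ := hlift t.prod
      (by simpa using monic_multiset_prod_of_monic t id fun y hy => (ht y hy).1)
      (Dvd.intro_left _ hQs.symm)
    have hQHT : Q = H * T := by
      apply map_injective _ (Int.castRingHom ℚ).injective_int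
      rw [Polynomial.map_mul, hQs, hH, hT]
    obtain ⟨A, hA⟩ := h H hHm (hH ▸ hx.2) ((Dvd.intro _ hQHT.symm).trans hQG)
    have hTle := ih ht T hTm hT ((Dvd.intro_left _ hQHT.symm).trans hQG) (fun x hx hxT =>
      hlift x hx (hxT.trans (map_dvd (mapRingHom (Int.castRingHom ℚ)) (Dvd.intro_left _ hQHT.symm))))
    have hHmap := hHm.map (Int.castRingHom (ZMod d))
    have hHle : N ≤ (normalizedFactors (H.map (Int.castRingHom (ZMod d)))).card := by
      rw [hA, normalizedFactors_pow, Multiset.card_nsmul]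
      refine Nat.le_mul_of_pos_right N (Multiset.card_pos.2 fun h0 => ?_)
      have hA0 : A ≠ 0 ∨ N = 0 := by
        by_contra hc
        push Not at hc
        exact hHmap.ne_zero (by rw [hA, hc.1, zero_pow hc.2])
      have hdeg : (H.map (Int.castRingHom (ZMod d))).natDegree ≠ 0 := by
        rw [hHm.natDegree_map, ← hHm.natDegree_map (Int.castRingHom ℚ), hH]
        exact hx.2.natDegree_pos.ne'
      rcases hA0 with hA0 | rfl
      · have hu := (normalizedFactors_eq_zero_iff hA0).1 h0
        rw [hA] at hdeg
        exact hdeg (natDegree_eq_zero_of_isUnit (hu.pow N))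
      · rw [hA, pow_zero, natDegree_one] at hdeg
        exact hdeg rfl
    rw [hQHT, Polynomial.map_mul, normalizedFactors_mul hHmap.ne_zero (hTm.map _).ne_zero,
      Multiset.card_add, Multiset.card_cons, add_mul, one_mul]
    omega

end Misiurewicz

theorem theorem1p4 (d m n : ℕ) [Fact d.Prime] (hm : 2 ≤ m) (hn : 1 ≤ n) :
    -- `G_{d,0,n}` and `G_{d,m,n}` are polynomials with integer coefficients `G₀` and `Gₘ`
    ∃ G₀ Gₘ : ℤ[X],
      algebraMap ℤ[X] (FractionRing ℤ[X]) G₀ = Misiurewicz.G d 0 n ∧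
      algebraMap ℤ[X] (FractionRing ℤ[X]) Gₘ = Misiurewicz.G d m n ∧
      -- the number of irreducible factors over `ℚ`, counted with multiplicity, is at most the
      -- number of distinct monic irreducible factors of the reduction of `G_{d,0,n}`
      (UniqueFactorizationMonoid.normalizedFactors (Gₘ.map (Int.castRingHom ℚ))).card ≤
        (UniqueFactorizationMonoid.primeFactors (G₀.map (Int.castRingHom (ZMod d)))).card ∧
      (Irreducible (G₀.map (Int.castRingHom (ZMod d))) →
        Irreducible (Gₘ.map (Int.castRingHom ℚ))) ∧
      -- every irreducible factor reduces modulo `d` to an `M_{m,n}`-th power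
      ∀ H : ℤ[X], H.Monic → Irreducible (H.map (Int.castRingHom ℚ)) → H ∣ Gₘ →
        ∃ A : (ZMod d)[X], H.map (Int.castRingHom (ZMod d)) = A ^ Misiurewicz.M d m n := by
  classical
  obtain ⟨j, rfl⟩ := Nat.exists_eq_add_of_le' (show 1 ≤ m by omega)
  have hj : 1 ≤ j := by omega
  have hd : 2 ≤ d := (Fact.out : d.Prime).two_le
  obtain ⟨G₀, G₁, hG₀, hG₁, hm₀, hm₁, hdvd₀, hdvd₁, hsub, hnd, hmap⟩ :=
    Misiurewicz.exists_polynomials d j n hj hn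
  have hM := Misiurewicz.M_pos hd hj n
  have hsq : Squarefree (G₀.map (Int.castRingHom (ZMod d))) :=
    (Misiurewicz.squarefree_map_orbit d hn).squarefree_of_dvd
      (map_dvd (mapRingHom (Int.castRingHom (ZMod d))) hdvd₀)
  have hthird : ∀ H : ℤ[X], H.Monic → Irreducible (H.map (Int.castRingHom ℚ)) → H ∣ G₁ →
      ∃ A : (ZMod d)[X], H.map (Int.castRingHom (ZMod d)) = A ^ Misiurewicz.M d (j + 1) n := by
    intro H hHm hH hHG
    have hHp : Prime H :=
      ((hHm.irreducible_iff_irreducible_map_fraction_map (K := ℚ)).2 hH).prime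
    refine Misiurewicz.exists_eq_pow_of_dvd_squarefree_pow (hHm.map _) hsq ?_ fun π hπ hπH =>
      Misiurewicz.le_multiplicity_map hj hn hdvd₀ hdvd₁ hsub hnd hmap hHm hHp hHG hπ hπH
    rw [← hmap]
    exact map_dvd (mapRingHom (Int.castRingHom (ZMod d))) hHG
  have hcard : (UniqueFactorizationMonoid.normalizedFactors (G₁.map (Int.castRingHom ℚ))).card ≤
      (UniqueFactorizationMonoid.primeFactors (G₀.map (Int.castRingHom (ZMod d)))).card := by
    have h1 := Misiurewicz.card_mul_le_card_normalizedFactors hthird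
      (UniqueFactorizationMonoid.normalizedFactors (G₁.map (Int.castRingHom ℚ)))
      (fun x hx => ?_) G₁ hm₁ ?_ dvd_rfl
    · rw [hmap, UniqueFactorizationMonoid.normalizedFactors_pow, Multiset.card_nsmul,
        mul_comm] at h1
      rw [← UniqueFactorizationMonoid.toFinset_normalizedFactors,
        Multiset.toFinset_card_of_nodup
          ((UniqueFactorizationMonoid.squarefree_iff_nodup_normalizedFactors hsq.ne_zero).1 hsq)]
      exact Nat.le_of_mul_le_mul_left h1 hM
    · have hirr := UniqueFactorizationMonoid.irreducible_of_normalized_factor x hx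
      refine ⟨?_, hirr⟩
      rw [← UniqueFactorizationMonoid.normalize_normalized_factor x hx]
      exact monic_normalize hirr.ne_zero
    · rw [UniqueFactorizationMonoid.prod_normalizedFactors_eq (hm₁.map _).ne_zero,
        (hm₁.map _).normalize_eq_self]
  refine ⟨G₀, G₁, hG₀, hG₁, hcard, fun hirr => ?_, hthird⟩
  have hpos : 0 < (G₁.map (Int.castRingHom ℚ)).natDegree := by
    rw [hm₁.natDegree_map, ← hm₁.natDegree_map (Int.castRingHom (ZMod d)), hmap, natDegree_pow]
    exact Nat.mul_pos hM hirr.natDegree_pos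
  have hne : G₁.map (Int.castRingHom ℚ) ≠ 0 := (hm₁.map _).ne_zero
  have hone : (UniqueFactorizationMonoid.primeFactors
      (G₀.map (Int.castRingHom (ZMod d)))).card = 1 := by
    rw [← UniqueFactorizationMonoid.toFinset_normalizedFactors,
      UniqueFactorizationMonoid.normalizedFactors_irreducible hirr, Multiset.toFinset_singleton,
      Finset.card_singleton]
  have hnz : UniqueFactorizationMonoid.normalizedFactors (G₁.map (Int.castRingHom ℚ)) ≠ 0 := by
    rw [Ne, UniqueFactorizationMonoid.normalizedFactors_eq_zero_iff hne]
    exact fun h => hpos.ne' (natDegree_eq_zero_of_isUnit h)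
  obtain ⟨x, hx⟩ := Multiset.card_eq_one.1
    (le_antisymm (hcard.trans hone.le) (Multiset.card_pos.2 hnz))
  have hmem : x ∈ UniqueFactorizationMonoid.normalizedFactors (G₁.map (Int.castRingHom ℚ)) :=
    hx ▸ Multiset.mem_singleton_self x
  have hassoc := UniqueFactorizationMonoid.prod_normalizedFactors hne
  rw [hx, Multiset.prod_singleton] at hassoc
  exact hassoc.irreducible_iff.1
    (UniqueFactorizationMonoid.irreducible_of_normalized_factor x hmem)
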